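/- Let $R$ be an integral domain with quotient field $K$. We say that $R$ has the Z-property if, whenever $a,b,c,d,e\in R$ are nonzero nonunits with $abc=de$, the elements $ab$ and $d$ have a common nonunit factor or the elements $ab$ and $e$ have a common nonunit factor. $R$ is a half-factorial domain (HFD) if it is atomic (every nonzero nonunit is a finite product of irreducible elements) and $m=n$ whenever $\alpha_1\cdots\alpha_n=\beta_1\cdots\beta_m$ with all $\alpha_i,\beta_j\in R$ irreducible. A primitive ideal of $R$ is an ideal generated by the coefficients of some primitive polynomial $f\in R[x]$, i.e. of a polynomial whose coefficients have only units of $R$ as common divisors. For a nonzero ideal $I$ of $R$ put $I^{-1}=\{u\in K : uI\subseteq R\}$ and $I_v=(I^{-1})^{-1}=\{u\in K : uI^{-1}\subseteq R\}$. Let $R$ be a Krull domain that is not a field. Then $R$ has the Z-property if and only if $R$ is an HFD and for each primitive ideal $I\subseteq R$ there exists an irreducible element $\alpha\in R$ such that $\alpha\in I_v$. -/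

import Mathlib

open scoped nonZeroDivisors

/-- The Z-property: whenever `a, b, c, d, e` are nonzero nonunits with `abc = de`, either `ab` and
`d` have a common nonunit factor or `ab` and `e` have one. (`IsRelPrime x y` says that every common
divisor of `x` and `y` is a unit, that is, that their greatest common divisor is `1`.) -/
def HasZProperty (R : Type*) [CommRing R] : Prop :=
  ∀ a b c d e : R, a ≠ 0 → b ≠ 0 → c ≠ 0 → d ≠ 0 → e ≠ 0 →
    ¬ IsUnit a → ¬ IsUnit b → ¬ IsUnit c → ¬ IsUnit d → ¬ IsUnit e →
    a * b * c = d * e → ¬ IsRelPrime (a * b) d ∨ ¬ IsRelPrime (a * b) e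

/-- Every nonzero nonunit is a finite product of irreducible elements. -/
def IsAtomicDomain (R : Type*) [CommRing R] : Prop :=
  ∀ x : R, x ≠ 0 → ¬ IsUnit x → ∃ s : Multiset R, (∀ a ∈ s, Irreducible a) ∧ s.prod = x

/-- Half-factorial domains: atomic, and two factorizations of the same element into irreducibles
have the same length. -/
structure IsHalfFactorialDomain (R : Type*) [CommRing R] : Prop where
  isDomain : IsDomain R
  isAtomic : IsAtomicDomain R
  card_eq : ∀ s t : Multiset R, (∀ a ∈ s, Irreducible a) → (∀ b ∈ t, Irreducible b) →
    s.prod = t.prod → Multiset.card s = Multiset.card t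

/-- Krull domains: the localizations at the height-one primes are discrete valuation rings, the
ring is the intersection of these localizations inside its field of fractions, and every nonzero
element lies in only finitely many height-one primes. Fields are Krull domains. -/
structure IsKrullDomain (R : Type*) [CommRing R] [IsDomain R] : Prop where
  isDiscreteValuationRing : ∀ (P : Ideal R) [P.IsPrime], P.height = 1 →
    IsDiscreteValuationRing (Localization.AtPrime P)
  mem_of_forall_mem_localization : ∀ x : FractionRing R,
    (∀ P : Ideal R, P.IsPrime → P.height = 1 →
      ∃ r s : R, s ∉ P ∧ x = algebraMap R (FractionRing R) r / algebraMap R (FractionRing R) s) →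
    ∃ r : R, x = algebraMap R (FractionRing R) r
  finite_height_one : ∀ x : R, x ≠ 0 →
    {P : Ideal R | P.IsPrime ∧ P.height = 1 ∧ x ∈ P}.Finite

/-- A primitive ideal is the ideal generated by the coefficients of a primitive polynomial, that
is, of a polynomial whose coefficients have only units as common divisors. -/
def IsPrimitiveIdeal {R : Type*} [CommRing R] (I : Ideal R) : Prop :=
  ∃ f : Polynomial R, f.IsPrimitive ∧ I = f.contentIdeal

/-- The `v`-closure `I_v = (I⁻¹)⁻¹`, where `J⁻¹ = (R : J)` is taken in the field of fractions. -/
noncomputable def vClosure {R : Type*} [CommRing R] [IsDomain R] (I : Ideal R) :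
    FractionalIdeal R⁰ (FractionRing R) :=
  ((I : FractionalIdeal R⁰ (FractionRing R))⁻¹)⁻¹

/-! ### Divisibility through the `v`-closure -/

section VClosure

variable {R : Type*} [CommRing R] [IsDomain R]

/-! Half-factoriality from Z: in a shortest counterexample `d * s = a * b * t`, Z lets a factor of
`a * b` be cancelled against `d` or `s`, and induction on length bounds `t` too tightly.

Irreducibles in `I_v` from Z: in a Krull domain, membership in `I_v` is tested by comparing orders
with the least orders on `I`. Take `x ≠ 0` in `I_v` minimal for divisibility. If `x` were a product
of two nonunits, approximation would give `d` with the orders of `I` along the support of `x`, and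
`e` with the complementary ones, so that `x ∣ d * e`. Primitivity makes `x` and `d` coprime, so Z
gives a common factor of `x` and `e`; removing it from `x` stays inside `I_v`, against minimality.

Conversely, if `a * b` is coprime to `d` and to `e`, the product of `(a * b, d)` and `(a * b, e)`
lies in `(a * b)`. Irreducibles `α`, `β` of the two `v`-closures then satisfy `a * b ∣ α * β`;
lengths make these associated, and `α` divides both `a * b` and `d`. -/

theorem mem_vClosure_iff {I : Ideal R} (hI : I ≠ ⊥) {x : FractionRing R} :
    x ∈ vClosure I ↔ ∀ u : FractionRing R,
      (∀ i ∈ I, ∃ r : R, algebraMap R (FractionRing R) r = u * algebraMap R (FractionRing R) i) →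
        ∃ r : R, algebraMap R (FractionRing R) r = x * u := by
  have hI' : (I : FractionalIdeal R⁰ (FractionRing R)) ≠ 0 :=
    FractionalIdeal.coeIdeal_ne_zero.mpr hI
  have hinv : ∀ u : FractionRing R, u ∈ (I : FractionalIdeal R⁰ (FractionRing R))⁻¹ ↔
      ∀ i ∈ I, ∃ r : R,
        algebraMap R (FractionRing R) r = u * algebraMap R (FractionRing R) i := by
    intro u
    rw [FractionalIdeal.mem_inv_iff hI']
    simp [FractionalIdeal.mem_coeIdeal, FractionalIdeal.mem_one_iff]
  have hne : (I : FractionalIdeal R⁰ (FractionRing R))⁻¹ ≠ 0 := by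
    intro h
    have h1 : (1 : FractionRing R) ∈ (I : FractionalIdeal R⁰ (FractionRing R))⁻¹ :=
      (hinv 1).2 fun i _ => ⟨i, by simp⟩
    rw [h, FractionalIdeal.mem_zero_iff] at h1
    exact one_ne_zero h1
  rw [vClosure, FractionalIdeal.mem_inv_iff hne]
  simp only [hinv, FractionalIdeal.mem_one_iff]

/-- The hypothesis says that `t / c` lies in `I⁻¹`, which `α` multiplies into `R`. -/
theorem dvd_mul_of_mem_vClosure {I : Ideal R} (hI : I ≠ ⊥) {α c t : R}
    (hα : algebraMap R (FractionRing R) α ∈ vClosure I) (hc : c ≠ 0)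
    (h : ∀ i ∈ I, c ∣ t * i) : c ∣ t * α := by
  have hc' : algebraMap R (FractionRing R) c ≠ 0 := by simpa using hc
  obtain ⟨r, hr⟩ := (mem_vClosure_iff hI).1 hα
    (algebraMap R (FractionRing R) t / algebraMap R (FractionRing R) c) fun i hi => by
      obtain ⟨k, hk⟩ := h i hi
      refine ⟨k, ?_⟩
      rw [div_mul_eq_mul_div, ← map_mul, hk, map_mul, mul_div_cancel_left₀ _ hc']
  refine ⟨r, IsFractionRing.injective R (FractionRing R) ?_⟩
  rw [map_mul, map_mul, hr]
  field_simp

theorem IsPrimitiveIdeal.ne_bot {I : Ideal R} (hI : IsPrimitiveIdeal I) : I ≠ ⊥ := by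
  obtain ⟨f, hf, rfl⟩ := hI
  rw [Ne, Polynomial.contentIdeal_eq_bot_iff]
  exact hf.ne_zero

end VClosure

/-! ### Primitive ideals -/

section PrimitiveIdeal

variable {R : Type*} [CommRing R]

theorem isPrimitiveIdeal_span_pair {x y : R} (h : IsRelPrime x y) :
    IsPrimitiveIdeal (Ideal.span {x, y}) := by
  refine ⟨Polynomial.C x + Polynomial.C y * Polynomial.X, fun r hr => ?_, le_antisymm ?_ ?_⟩
  · rw [Polynomial.C_dvd_iff_dvd_coeff] at hr
    refine h ?_ ?_
    · simpa using hr 0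
    · simpa using hr 1
  · have hmem := Polynomial.coeff_mem_contentIdeal
      (Polynomial.C x + Polynomial.C y * Polynomial.X)
    rw [Ideal.span_le]
    rintro z (rfl | rfl)
    · convert hmem 0
      simp
    · convert hmem 1
      simp
  · rw [Polynomial.contentIdeal_def, Ideal.span_le]
    intro z hz
    obtain ⟨n, -, rfl⟩ := Polynomial.mem_coeffs_iff.1 (Finset.mem_coe.1 hz)
    rcases n with _ | _ | n
    · simpa using Ideal.subset_span (by simp)
    · simpa using Ideal.subset_span (by simp)
    · simp

theorem IsPrimitiveIdeal.isUnit_of_forall_dvd {I : Ideal R} (hI : IsPrimitiveIdeal I) {r : R}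
    (h : ∀ i ∈ I, r ∣ i) : IsUnit r := by
  obtain ⟨f, hf, rfl⟩ := hI
  exact hf r (Polynomial.C_dvd_iff_dvd_coeff _ _ |>.2 fun n =>
    h _ (Polynomial.coeff_mem_contentIdeal _ _))

end PrimitiveIdeal

/-! ### The Z-property and lengths of factorizations -/

section HalfFactorial

variable {R : Type*} [CommRing R]

theorem Multiset.eq_zero_of_irreducible_of_isUnit_prod {s : Multiset R}
    (hs : ∀ a ∈ s, Irreducible a) (h : IsUnit s.prod) : s = 0 := by
  rcases s.empty_or_exists_mem with rfl | ⟨a, ha⟩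
  · rfl
  · exact absurd (isUnit_of_dvd_unit (Multiset.dvd_prod ha) h) (hs a ha).not_isUnit

theorem Multiset.card_pos_of_not_isUnit_prod {s : Multiset R} (h : ¬ IsUnit s.prod) :
    0 < Multiset.card s := by
  rw [Multiset.card_pos]
  rintro rfl
  simp at h

theorem IsAtomicDomain.exists_associated (hA : IsAtomicDomain R) {x : R} (hx : x ≠ 0) :
    ∃ s : Multiset R, (∀ a ∈ s, Irreducible a) ∧ Associated s.prod x := by
  by_cases hu : IsUnit x
  · exact ⟨0, by simp, by simpa using (associated_one_iff_isUnit.2 hu).symm⟩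
  · obtain ⟨s, hs, rfl⟩ := hA x hx hu
    exact ⟨s, hs, Associated.refl _⟩

theorem IsAtomicDomain.exists_irreducible_dvd (hA : IsAtomicDomain R) {x : R} (hx : x ≠ 0)
    (hu : ¬ IsUnit x) : ∃ p, Irreducible p ∧ p ∣ x := by
  obtain ⟨s, hs, rfl⟩ := hA x hx hu
  obtain ⟨a, ha⟩ := Multiset.card_pos_iff_exists_mem.1 (Multiset.card_pos_of_not_isUnit_prod hu)
  exact ⟨a, hs a ha, Multiset.dvd_prod ha⟩

theorem Irreducible.not_isUnit_of_mul_eq_mul {a b p x : R} (ha : Irreducible a)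
    (hb : Irreducible b) (hp : Irreducible p) (h : a * b = p * x) : ¬ IsUnit x := by
  intro hx
  have hab : Irreducible (a * b) := by rw [h]; exact (irreducible_mul_isUnit hx).2 hp
  rcases hab.isUnit_or_isUnit rfl with hu | hu
  · exact ha.not_isUnit hu
  · exact hb.not_isUnit hu

variable [IsDomain R]

theorem Multiset.prod_ne_zero_of_irreducible {s : Multiset R} (hs : ∀ a ∈ s, Irreducible a) :
    s.prod ≠ 0 :=
  Multiset.prod_ne_zero fun h => (hs 0 h).ne_zero rfl

/-- If `x` is a nonunit, a factorization of `x * t.prod` of length `k` forces `t` to be shorter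
than `k`. -/
theorem IsAtomicDomain.card_lt_of_associated_mul (hA : IsAtomicDomain R) {k : ℕ}
    (ih : ∀ s t : Multiset R, (∀ a ∈ s, Irreducible a) → (∀ a ∈ t, Irreducible a) →
      Multiset.card s = k → Associated s.prod t.prod → Multiset.card t = k)
    {s t : Multiset R} (hs : ∀ a ∈ s, Irreducible a) (ht : ∀ a ∈ t, Irreducible a)
    (hk : Multiset.card s = k) {x : R} (hx : ¬ IsUnit x) (h : Associated s.prod (x * t.prod)) :
    Multiset.card t < k := by
  have hx0 : x ≠ 0 := by
    rintro rfl
    rw [zero_mul, associated_zero_iff_eq_zero] at h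
    exact Multiset.prod_ne_zero_of_irreducible hs h
  obtain ⟨w, hw, rfl⟩ := hA x hx0 hx
  have := ih s (w + t) hs
    (fun a ha => (Multiset.mem_add.1 ha).elim (hw a) (ht a)) hk (by simpa using h)
  have hpos := Multiset.card_pos_of_not_isUnit_prod hx
  rw [Multiset.card_add] at this
  omega

theorem HasZProperty.card_eq_of_associated (hA : IsAtomicDomain R) (hZ : HasZProperty R) (m : ℕ) :
    ∀ s t : Multiset R, (∀ a ∈ s, Irreducible a) → (∀ a ∈ t, Irreducible a) →
      Multiset.card s = m → Associated s.prod t.prod → Multiset.card t = m := by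
  induction m using Nat.strong_induction_on with
  | _ m ih =>
  intro s t hs ht hm hst
  -- If `t` is the shorter side, the induction hypothesis applies with the roles exchanged; only a
  -- longer `t` needs Z.
  rcases lt_trichotomy (Multiset.card t) m with hlt | heq | hgt
  · have := ih _ hlt t s ht hs rfl hst.symm
    omega
  · exact heq
  exfalso
  induction s using Multiset.induction with
  | empty =>
    have := Multiset.eq_zero_of_irreducible_of_isUnit_prod ht (by simpa using hst.symm)
    subst this
    simp at hgt
  | cons d s _ =>
  obtain ⟨a, ha⟩ := Multiset.card_pos_iff_exists_mem.1 (by omega : 0 < Multiset.card t)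
  obtain ⟨t, rfl⟩ := Multiset.exists_cons_of_mem ha
  rw [Multiset.card_cons] at hm hgt
  obtain ⟨b, hb⟩ := Multiset.card_pos_iff_exists_mem.1 (by omega : 0 < Multiset.card t)
  obtain ⟨t, rfl⟩ := Multiset.exists_cons_of_mem hb
  rw [Multiset.card_cons] at hgt
  simp only [Multiset.mem_cons, forall_eq_or_imp] at hs ht
  obtain ⟨hd, hs⟩ := hs
  obtain ⟨ha, hb, ht⟩ := ht
  simp only [Multiset.prod_cons] at hst
  have ht0 := Multiset.prod_ne_zero_of_irreducible ht
  have hs0 := Multiset.prod_ne_zero_of_irreducible hs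
  by_cases hsu : IsUnit s.prod
  · have h1 : Irreducible (a * (b * t.prod)) :=
      (hst.irreducible_iff).1 ((irreducible_mul_isUnit hsu).2 hd)
    rcases h1.isUnit_or_isUnit rfl with hu | hu
    · exact ha.not_isUnit hu
    · exact hb.not_isUnit (isUnit_of_mul_isUnit_left hu)
  have hscard := Multiset.card_pos_of_not_isUnit_prod hsu
  have htu : ¬ IsUnit t.prod := by
    intro hu
    have := Multiset.eq_zero_of_irreducible_of_isUnit_prod ht hu
    subst this
    simp at hgt
    omega
  obtain ⟨u, hu⟩ := hst.symm
  have hprod : a * b * (t.prod * u) = d * s.prod := by rw [← hu]; ring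
  have key := hZ a b (t.prod * u) d s.prod ha.ne_zero hb.ne_zero (by simpa using ht0) hd.ne_zero
    hs0 ha.not_isUnit hb.not_isUnit (by simpa using htu) hd.not_isUnit hsu hprod
  have ihm := ih (m - 1) (by omega)
  simp only [IsRelPrime, not_forall] at key
  rcases key with ⟨γ, h1, h2, h3⟩ | ⟨γ, h1, h2, h3⟩
  -- Cancelling `d` leaves `s` associated to `x * t` with `x` a nonunit, so `t` has fewer than `m -
  -- 1` factors, contradicting `hgt`.
  · have hdab : d ∣ a * b := ((hd.dvd_iff.1 h2).resolve_left h3).dvd.trans h1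
    obtain ⟨x, hx⟩ := hdab
    have := hA.card_lt_of_associated_mul ihm hs ht (by omega)
      (ha.not_isUnit_of_mul_eq_mul hb hd hx) (by
        refine Associated.symm ⟨u, mul_left_cancel₀ hd.ne_zero ?_⟩
        rw [← hprod, hx]; ring)
    omega
  -- Replacing `s` by `p * z` keeps its length, so after cancelling `p` the side `d * z` has length
  -- `m - 1` and bounds `t` as before.
  · obtain ⟨p, hp, hpγ⟩ := hA.exists_irreducible_dvd (ne_zero_of_dvd_ne_zero hs0 h2) h3
    obtain ⟨x, hx⟩ := hpγ.trans h1
    obtain ⟨y, hy⟩ := hpγ.trans h2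
    have hy0 : y ≠ 0 := by rintro rfl; exact hs0 (by simpa using hy)
    obtain ⟨z, hz, hzy⟩ := hA.exists_associated hy0
    have hzcard := ihm s (p ::ₘ z) hs (by simpa using ⟨hp, hz⟩) (by omega) (by
      rw [hy, Multiset.prod_cons]; exact hzy.symm.mul_left p)
    rw [Multiset.card_cons] at hzcard
    have := hA.card_lt_of_associated_mul ihm (s := d ::ₘ z) (by simpa using ⟨hd, hz⟩) ht
      (by rw [Multiset.card_cons]; omega) (ha.not_isUnit_of_mul_eq_mul hb hp hx) (by
        rw [Multiset.prod_cons]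
        refine (hzy.mul_left d).trans (Associated.symm ⟨u, mul_left_cancel₀ hp.ne_zero ?_⟩)
        calc p * (x * t.prod * u) = p * x * (t.prod * u) := by ring
          _ = d * s.prod := by rw [← hx, hprod]
          _ = p * (d * y) := by rw [hy]; ring)
    omega

theorem HasZProperty.isHalfFactorialDomain (hA : IsAtomicDomain R) (hZ : HasZProperty R) :
    IsHalfFactorialDomain R where
  isDomain := inferInstance
  isAtomic := hA
  card_eq s t hs ht h :=
    (hZ.card_eq_of_associated hA _ s t hs ht rfl (Associated.of_eq h)).symm

/-- The product has length two, which `a` and `b` already exhaust. -/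
theorem IsHalfFactorialDomain.isUnit_of_mul_eq (h : IsHalfFactorialDomain R) {α β a b t : R}
    (hα : Irreducible α) (hβ : Irreducible β) (ha : ¬ IsUnit a) (hb : ¬ IsUnit b)
    (heq : α * β = a * b * t) : IsUnit t := by
  by_contra ht
  have h0 : a * b * t ≠ 0 := by rw [← heq]; exact mul_ne_zero hα.ne_zero hβ.ne_zero
  simp only [mul_ne_zero_iff] at h0
  obtain ⟨sa, hsa, rfl⟩ := h.isAtomic a h0.1.1 ha
  obtain ⟨sb, hsb, rfl⟩ := h.isAtomic b h0.1.2 hb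
  obtain ⟨st, hst, rfl⟩ := h.isAtomic t h0.2 ht
  have := h.card_eq {α, β} (sa + sb + st) (by simpa using ⟨hα, hβ⟩)
    (by
      simp only [Multiset.mem_add]
      rintro c ((hc | hc) | hc)
      exacts [hsa c hc, hsb c hc, hst c hc]) (by simpa using heq)
  have h1 := Multiset.card_pos_of_not_isUnit_prod ha
  have h2 := Multiset.card_pos_of_not_isUnit_prod hb
  have h3 := Multiset.card_pos_of_not_isUnit_prod ht
  simp at this
  omega

theorem IsHalfFactorialDomain.hasZProperty (h : IsHalfFactorialDomain R)
    (hI : ∀ I : Ideal R, IsPrimitiveIdeal I →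
      ∃ α : R, Irreducible α ∧ algebraMap R (FractionRing R) α ∈ vClosure I) :
    HasZProperty R := by
  intro a b c d e ha hb hc hd he hau hbu hcu hdu heu heq
  by_contra! hcon
  obtain ⟨hd', he'⟩ := hcon
  have hx0 : a * b ≠ 0 := mul_ne_zero ha hb
  have hdP := isPrimitiveIdeal_span_pair hd'
  have heP := isPrimitiveIdeal_span_pair he'
  obtain ⟨α, hα, hαv⟩ := hI _ hdP
  obtain ⟨β, hβ, hβv⟩ := hI _ heP
  have hmul : ∀ i ∈ Ideal.span {a * b, d}, ∀ j ∈ Ideal.span {a * b, e}, a * b ∣ i * j := by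
    intro i hi j hj
    obtain ⟨i₁, i₂, rfl⟩ := Ideal.mem_span_pair.1 hi
    obtain ⟨j₁, j₂, rfl⟩ := Ideal.mem_span_pair.1 hj
    exact ⟨i₁ * j₁ * (a * b) + i₁ * j₂ * e + i₂ * d * j₁ + i₂ * j₂ * c, by
      linear_combination -(i₂ * j₂) * heq⟩
  have hβi : ∀ i ∈ Ideal.span {a * b, d}, a * b ∣ i * β := fun i hi =>
    dvd_mul_of_mem_vClosure heP.ne_bot hβv hx0 (hmul i hi)
  obtain ⟨t, ht⟩ : a * b ∣ β * α := dvd_mul_of_mem_vClosure hdP.ne_bot hαv hx0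
    fun i hi => by rw [mul_comm β]; exact hβi i hi
  -- With `a * b` associated to `β * α`, cancelling `β` from `a * b ∣ d * β` will give `α ∣ d`.
  obtain ⟨r, hr⟩ := hβi d (Ideal.subset_span (by simp))
  obtain ⟨u, rfl⟩ := h.isUnit_of_mul_eq hβ hα hau hbu ht
  have hab : a * b = β * α * ↑u⁻¹ := by rw [ht, mul_assoc, u.mul_inv, mul_one]
  refine hα.not_isUnit (hd' ⟨β * ↑u⁻¹, by rw [hab]; ring⟩ ⟨↑u⁻¹ * r, mul_right_cancel₀ hβ.ne_zero ?_⟩)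
  rw [hr, hab]; ring

end HalfFactorial

/-! ### Orders at height-one primes and approximation in Krull domains -/

section Krull

/-- The prime ideals of height one. -/
abbrev HeightOnePrime (R : Type*) [CommRing R] := {P : Ideal R // P.IsPrime ∧ P.height = 1}

theorem HeightOnePrime.eq_of_le {R : Type*} [CommRing R] (P Q : HeightOnePrime R) (h : P.1 ≤ Q.1) : P = Q := by
  have := P.2.1
  have := Q.2.1
  have : P.1.FiniteHeight := P.1.finiteHeight_iff.2 (Or.inr (by rw [P.2.2]; simp))
  by_contra hne
  have := Ideal.height_strict_mono_of_isPrime (lt_of_le_of_ne h fun h' => hne (Subtype.ext h'))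
  rw [P.2.2, Q.2.2] at this
  exact lt_irrefl _ this

namespace IsKrullDomain

variable {R : Type*} [CommRing R] [IsDomain R]

/-- The order of vanishing of an element of a Krull domain at a height-one prime. -/
noncomputable def ord (hK : IsKrullDomain R) (P : HeightOnePrime R) : AddValuation R ℕ∞ :=
  haveI := P.2.1
  haveI := hK.isDiscreteValuationRing P.1 P.2.2
  (IsDiscreteValuationRing.addVal (Localization.AtPrime P.1)).comap
    (algebraMap R (Localization.AtPrime P.1))

theorem ord_apply (hK : IsKrullDomain R) (P : HeightOnePrime R) [P.1.IsPrime]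
    [IsDiscreteValuationRing (Localization.AtPrime P.1)] (x : R) :
    hK.ord P x = IsDiscreteValuationRing.addVal (Localization.AtPrime P.1)
      (algebraMap R (Localization.AtPrime P.1) x) := rfl

theorem ord_eq_top_iff (hK : IsKrullDomain R) (P : HeightOnePrime R) {x : R} :
    hK.ord P x = ⊤ ↔ x = 0 := by
  have := P.2.1
  have := hK.isDiscreteValuationRing P.1 P.2.2
  rw [ord_apply, IsDiscreteValuationRing.addVal_eq_top_iff,
    FaithfulSMul.algebraMap_eq_zero_iff]

theorem ord_eq_zero_iff (hK : IsKrullDomain R) (P : HeightOnePrime R) {x : R} :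
    hK.ord P x = 0 ↔ x ∉ P.1 := by
  have := P.2.1
  have := hK.isDiscreteValuationRing P.1 P.2.2
  rw [ord_apply, IsDiscreteValuationRing.addVal_eq_zero_iff]
  exact IsLocalization.AtPrime.isUnit_to_map_iff _ P.1 x

theorem ord_eq_zero_of_isUnit (hK : IsKrullDomain R) (P : HeightOnePrime R) {x : R}
    (hx : IsUnit x) : hK.ord P x = 0 :=
  (hK.ord_eq_zero_iff P).2 fun h => P.2.1.ne_top (Ideal.eq_top_of_isUnit_mem _ h hx)

theorem ord_le_iff (hK : IsKrullDomain R) (P : HeightOnePrime R) {x y : R} :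
    hK.ord P x ≤ hK.ord P y ↔ ∃ s ∉ P.1, ∃ r, s * y = r * x := by
  have := P.2.1
  have := hK.isDiscreteValuationRing P.1 P.2.2
  have hinj := FaithfulSMul.algebraMap_injective R (Localization.AtPrime P.1)
  rw [ord_apply, ord_apply, IsDiscreteValuationRing.addVal_le_iff_dvd]
  constructor
  · rintro ⟨z, hz⟩
    obtain ⟨r, s, rfl⟩ := IsLocalization.exists_mk'_eq P.1.primeCompl z
    refine ⟨s, s.2, r, hinj ?_⟩
    rw [map_mul, map_mul, hz, mul_left_comm, IsLocalization.mk'_spec', mul_comm]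
  · rintro ⟨s, hs, r, h⟩
    refine (IsUnit.dvd_mul_left (IsLocalization.map_units _ (⟨s, hs⟩ : P.1.primeCompl))).1
      ⟨algebraMap R _ r, ?_⟩
    rw [← map_mul, ← map_mul, h, mul_comm]

theorem exists_ord_eq_one (hK : IsKrullDomain R) (P : HeightOnePrime R) :
    ∃ x, hK.ord P x = 1 := by
  have := P.2.1
  have := hK.isDiscreteValuationRing P.1 P.2.2
  obtain ⟨ϖ, hϖ⟩ := IsDiscreteValuationRing.exists_irreducible (Localization.AtPrime P.1)
  obtain ⟨r, s, rfl⟩ := IsLocalization.exists_mk'_eq P.1.primeCompl ϖ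
  refine ⟨r, ?_⟩
  rw [ord_apply, ← IsLocalization.mk'_spec _ r s, IsDiscreteValuationRing.addVal_mul,
    IsDiscreteValuationRing.addVal_uniformizer hϖ,
    IsDiscreteValuationRing.addVal_eq_zero_iff.2 (IsLocalization.map_units _ s), add_zero]

theorem dvd_of_forall_ord_le (hK : IsKrullDomain R) {x y : R} (hx : x ≠ 0)
    (h : ∀ P, hK.ord P x ≤ hK.ord P y) : x ∣ y := by
  have hx' : algebraMap R (FractionRing R) x ≠ 0 := by simpa using hx
  obtain ⟨r, hr⟩ := hK.mem_of_forall_mem_localization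
    (algebraMap R (FractionRing R) y / algebraMap R (FractionRing R) x) fun P hP hP1 => by
      obtain ⟨s, hs, r, hrs⟩ := (hK.ord_le_iff ⟨P, hP, hP1⟩).1 (h ⟨P, hP, hP1⟩)
      have hs' : algebraMap R (FractionRing R) s ≠ 0 := by
        simp only [ne_eq, FaithfulSMul.algebraMap_eq_zero_iff]
        rintro rfl
        exact hs P.zero_mem
      refine ⟨r, s, hs, ?_⟩
      rw [div_eq_div_iff hx' hs', ← map_mul, ← map_mul, ← hrs, mul_comm]
  refine ⟨r, IsFractionRing.injective R (FractionRing R) ?_⟩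
  rw [map_mul, ← hr, mul_div_cancel₀ _ hx']

theorem dvd_iff (hK : IsKrullDomain R) {x y : R} (hx : x ≠ 0) :
    x ∣ y ↔ ∀ P, hK.ord P x ≤ hK.ord P y := by
  refine ⟨?_, hK.dvd_of_forall_ord_le hx⟩
  rintro ⟨z, rfl⟩ P
  rw [AddValuation.map_mul]
  exact le_self_add

/-- For `u` in `I⁻¹`, comparison with `i` puts `x * u` in each localization, hence in `R`. -/
theorem mem_vClosure_of_forall_exists_ord_le (hK : IsKrullDomain R) {I : Ideal R} (hI : I ≠ ⊥)
    {x : R} (h : ∀ P, ∃ i ∈ I, hK.ord P i ≤ hK.ord P x) :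
    algebraMap R (FractionRing R) x ∈ vClosure I := by
  rw [mem_vClosure_iff hI]
  intro u hu
  obtain ⟨r, hr⟩ := hK.mem_of_forall_mem_localization (algebraMap R (FractionRing R) x * u)
    fun P hP hP1 => by
      obtain ⟨i, hi, hle⟩ := h ⟨P, hP, hP1⟩
      obtain ⟨s, hs, w, hw⟩ := (hK.ord_le_iff ⟨P, hP, hP1⟩).1 hle
      obtain ⟨t, ht⟩ := hu i hi
      have hs' : algebraMap R (FractionRing R) s ≠ 0 := by
        simp only [ne_eq, FaithfulSMul.algebraMap_eq_zero_iff]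
        rintro rfl
        exact hs P.zero_mem
      refine ⟨w * t, s, hs, ?_⟩
      rw [eq_div_iff hs', map_mul, ht]
      have hw' := congrArg (algebraMap R (FractionRing R)) hw
      rw [map_mul, map_mul] at hw'
      linear_combination u * hw'
  exact ⟨r, hr.symm⟩

theorem finite_setOf_ord_ne_zero (hK : IsKrullDomain R) {x : R} (hx : x ≠ 0) :
    {P | hK.ord P x ≠ 0}.Finite := by
  refine Set.Finite.of_finite_image (f := Subtype.val)
    ((hK.finite_height_one x hx).subset ?_) Subtype.val_injective.injOn
  rintro _ ⟨P, hP, rfl⟩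
  exact ⟨P.2.1, P.2.2, by simpa [ord_eq_zero_iff] using hP⟩

theorem wfDvdMonoid (hK : IsKrullDomain R) : WfDvdMonoid R := by
  classical
  -- The total order strictly increases along proper divisibility; `⊤` at zero is needed because
  -- zero is a proper multiple of every nonzero element.
  let N : R → ℕ∞ := fun x => if x = 0 then ⊤ else ((∑ᶠ P, (hK.ord P x).toNat : ℕ) : ℕ∞)
  refine ⟨Subrelation.wf ?_ (InvImage.wf N wellFounded_lt)⟩
  rintro a b ⟨ha, c, hc, rfl⟩
  change N a < N (a * c)
  by_cases hc0 : c = 0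
  · simp only [N, if_neg ha, hc0, mul_zero, if_true]
    exact ENat.natCast_lt_top _
  simp only [N, if_neg ha, if_neg (mul_ne_zero ha hc0), Nat.cast_lt]
  have hfin : ∀ {x : R}, x ≠ 0 → (Function.support fun P => (hK.ord P x).toNat).Finite :=
    fun {x} hx => (hK.finite_setOf_ord_ne_zero hx).subset fun P hP => by
      intro h0
      simp [h0] at hP
  have hadd : ∀ P, (hK.ord P (a * c)).toNat = (hK.ord P a).toNat + (hK.ord P c).toNat := fun P => by
    rw [AddValuation.map_mul, ENat.toNat_add ((hK.ord_eq_top_iff P).not.2 ha)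
      ((hK.ord_eq_top_iff P).not.2 hc0)]
  rw [finsum_congr hadd, finsum_add_distrib (hfin ha) (hfin hc0)]
  obtain ⟨P, hP⟩ : ∃ P, hK.ord P c ≠ 0 := by
    by_contra! hcon
    exact hc (isUnit_of_dvd_one ((hK.dvd_iff hc0).2 fun P => by simp [hcon P]))
  have hle := single_le_finsum P (hfin hc0) fun _ => Nat.zero_le _
  have hpos : 0 < (hK.ord P c).toNat := by
    rw [Nat.pos_iff_ne_zero, Ne, ENat.toNat_eq_zero, not_or]
    exact ⟨hP, (hK.ord_eq_top_iff P).not.2 hc0⟩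
  omega

theorem isAtomicDomain (hK : IsKrullDomain R) : IsAtomicDomain R := by
  intro x hx hu
  have := hK.wfDvdMonoid
  obtain ⟨s, hs, rfl, -⟩ := (WfDvdMonoid.not_isUnit_iff_exists_factors_eq x hx).1 hu
  exact ⟨s, hs, rfl⟩

/-- The elements vanishing to order at least two. -/
def secondSymbolicPower (hK : IsKrullDomain R) (P : HeightOnePrime R) : Ideal R where
  carrier := {x | 2 ≤ hK.ord P x}
  add_mem' hx hy := (hK.ord P).map_le_add hx hy
  zero_mem' := by simp
  smul_mem' c x hx := by
    simp only [Set.mem_ofPred_eq, smul_eq_mul, AddValuation.map_mul] at hx ⊢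
    exact hx.trans le_add_self

theorem mem_secondSymbolicPower (hK : IsKrullDomain R) {P : HeightOnePrime R} {x : R} :
    x ∈ hK.secondSymbolicPower P ↔ 2 ≤ hK.ord P x := Iff.rfl

/-- Prime avoidance: otherwise `P` is covered by its elements of order at least two and the other
primes of `S`. Avoidance tolerates the one ideal not known to be prime. -/
theorem exists_ord_eq_one_and_forall_ord_eq_zero (hK : IsKrullDomain R) (P : HeightOnePrime R)
    (S : Finset (HeightOnePrime R)) :
    ∃ x, hK.ord P x = 1 ∧ ∀ Q ∈ S, Q ≠ P → hK.ord Q x = 0 := by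
  classical
  by_contra! hcon
  let f : Option (HeightOnePrime R) → Ideal R := fun o => o.elim (hK.secondSymbolicPower P) (·.1)
  have hsub : (P.1 : Set R) ⊆ ⋃ o ∈ ((Finset.insertNone (S.erase P) : Finset _) : Set _), f o := by
    intro x hx
    simp only [Set.mem_iUnion, SetLike.mem_coe]
    by_cases h2 : 2 ≤ hK.ord P x
    · exact ⟨none, by simp, h2⟩
    · have h0 : hK.ord P x ≠ 0 := by simpa [ord_eq_zero_iff] using hx
      have h1 : hK.ord P x = 1 := by
        refine le_antisymm ?_ (Order.one_le_iff_ne_zero.2 h0)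
        exact ENat.lt_add_one_iff (by simp) |>.1 (by simpa [one_add_one_eq_two] using h2)
      obtain ⟨Q, hQ, hQP, hne⟩ := hcon x h1
      exact ⟨some Q, by simp [hQ, hQP], not_not.1 ((hK.ord_eq_zero_iff Q).not.1 hne)⟩
  obtain ⟨o, ho, hle⟩ := (Ideal.subset_union_prime none none (by
    rintro (_ | Q) _ h _
    · exact absurd rfl h
    · exact Q.2.1)).1 hsub
  rcases o with _ | Q
  · obtain ⟨x, hx⟩ := hK.exists_ord_eq_one P
    have hxP : x ∈ P.1 := by
      by_contra h
      rw [(hK.ord_eq_zero_iff P).2 h] at hx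
      exact zero_ne_one hx
    have := hK.mem_secondSymbolicPower.1 (hle hxP)
    rw [hx] at this
    exact absurd this (by norm_num)
  · have hPQ := HeightOnePrime.eq_of_le P Q hle
    simp [hPQ] at ho

/-- Multiply powers of elements that have order one at one prime and zero at the rest of `S`. -/
theorem exists_forall_ord_eq (hK : IsKrullDomain R) (S : Finset (HeightOnePrime R))
    (n : HeightOnePrime R → ℕ) : ∃ x ≠ 0, ∀ P ∈ S, hK.ord P x = n P := by
  classical
  choose π hπ1 hπ0 using fun P => hK.exists_ord_eq_one_and_forall_ord_eq_zero P S
  have hord : ∀ Q ∈ S, ∀ T ⊆ S,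
      hK.ord Q (∏ P ∈ T, π P ^ n P) = if Q ∈ T then (n Q : ℕ∞) else 0 := by
    intro Q hQ T
    induction T using Finset.induction_on with
    | empty => simp
    | insert P T hPT ih =>
      intro hT
      rw [Finset.prod_insert hPT, AddValuation.map_mul, AddValuation.map_pow,
        ih ((Finset.subset_insert P T).trans hT)]
      by_cases h : Q = P
      · subst h
        simp [hπ1, hPT]
      · simp [hπ0 P Q hQ h, h]
  refine ⟨∏ P ∈ S, π P ^ n P, Finset.prod_ne_zero_iff.2 fun P _ => pow_ne_zero _ ?_, fun P hP => ?_⟩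
  · intro h
    have := hπ1 P
    rw [h, AddValuation.map_zero] at this
    exact absurd this (by simp)
  · rw [hord P hP S subset_rfl, if_pos hP]

theorem exists_irreducible_mem_vClosure (hK : IsKrullDomain R) (hR : ¬ IsField R)
    (hZ : HasZProperty R) {I : Ideal R} (hI : IsPrimitiveIdeal I) :
    ∃ α : R, Irreducible α ∧ algebraMap R (FractionRing R) α ∈ vClosure I := by
  -- `m P` realizes the minimal order at `P` of an element of `I`
  have hmin : ∀ P, ∃ i ∈ I, ∀ j ∈ I, hK.ord P i ≤ hK.ord P j := fun P => by
    obtain ⟨i, hi, hle⟩ := exists_minimalFor_of_wellFoundedLT (· ∈ I) (hK.ord P) ⟨0, I.zero_mem⟩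
    exact ⟨i, hi, fun j hj => (le_total (hK.ord P i) (hK.ord P j)).elim id (hle hj)⟩
  choose m hmI hm using hmin
  have hmem : ∀ {x : R}, (∀ P, hK.ord P (m P) ≤ hK.ord P x) →
      algebraMap R (FractionRing R) x ∈ vClosure I := fun h =>
    hK.mem_vClosure_of_forall_exists_ord_le hI.ne_bot fun P => ⟨m P, hmI P, h P⟩
  -- Here every element of `R` lies in `I_v`, so any irreducible serves; one exists because `R` is
  -- not a field.
  by_cases htriv : ∀ P, hK.ord P (m P) = 0
  · obtain ⟨x, hx0, hxu⟩ := Ring.exists_not_isUnit_of_not_isField hR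
    obtain ⟨p, hp, -⟩ := hK.isAtomicDomain.exists_irreducible_dvd hx0 hxu
    exact ⟨p, hp, hmem fun P => by simp [htriv P]⟩
  have hnu : ∀ {x : R}, (∀ P, hK.ord P (m P) ≤ hK.ord P x) → ¬ IsUnit x := fun h hu =>
    htriv fun P => by simpa [hK.ord_eq_zero_of_isUnit P hu] using h P
  obtain ⟨i, hi, hi0⟩ := Submodule.exists_mem_ne_zero_of_ne_bot hI.ne_bot
  obtain ⟨x, ⟨hx0, hx⟩, hxmin⟩ := hK.wfDvdMonoid.wf.has_min
    {x | x ≠ 0 ∧ ∀ P, hK.ord P (m P) ≤ hK.ord P x} ⟨i, hi0, fun P => hm P i hi⟩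
  refine ⟨x, ⟨hnu hx, fun a b hab => ?_⟩, hmem hx⟩
  by_contra! hab'
  obtain ⟨hau, hbu⟩ := hab'
  have hab0 : a ≠ 0 ∧ b ≠ 0 := by rwa [hab, mul_ne_zero_iff] at hx0
  have htop : ∀ {y : R} (P), y ≠ 0 → hK.ord P y ≠ ⊤ := fun P hy => (hK.ord_eq_top_iff P).not.2 hy
  have hmtop : ∀ P, hK.ord P (m P) ≠ ⊤ := fun P => ne_top_of_le_ne_top (htop P hx0) (hx P)
  -- `d` and `e` have orders `m P` and `ord P x - m P` wherever `x` vanishes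
  let S := (hK.finite_setOf_ord_ne_zero hx0).toFinset
  have hS : ∀ P, P ∉ S → hK.ord P x = 0 := fun P hP => by simpa [S] using hP
  obtain ⟨d, hd0, hd⟩ := hK.exists_forall_ord_eq S fun P => (hK.ord P (m P)).toNat
  obtain ⟨e, he0, he⟩ := hK.exists_forall_ord_eq S
    fun P => (hK.ord P x).toNat - (hK.ord P (m P)).toNat
  have hd' : ∀ P ∈ S, hK.ord P d = hK.ord P (m P) := fun P hP => by
    rw [hd P hP, ENat.natCast_toNat (hmtop P)]
  have he' : ∀ P ∈ S, hK.ord P (m P) + hK.ord P e = hK.ord P x := fun P hP => by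
    have h1 := hx P
    rw [he P hP]
    rw [← ENat.natCast_toNat (hmtop P), ← ENat.natCast_toNat (htop P hx0)] at h1 ⊢
    simp only [ENat.toNat_natCast]
    norm_cast at h1 ⊢
    omega
  -- A common divisor has order at most `m P` on `S` and zero off `S`, so it divides all of `I`.
  have hrel : IsRelPrime x d := fun r hrx hrd => hI.isUnit_of_forall_dvd fun j hj => by
    have hr0 := ne_zero_of_dvd_ne_zero hx0 hrx
    rw [hK.dvd_iff hr0] at hrx hrd ⊢
    intro P
    by_cases hP : P ∈ S
    · exact (hrd P).trans ((hd' P hP).trans_le (hm P j hj))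
    · have := hrx P
      rw [hS P hP] at this
      exact this.trans zero_le
  obtain ⟨c, hc⟩ : x ∣ d * e := (hK.dvd_iff hx0).2 fun P => by
    by_cases hP : P ∈ S
    · rw [AddValuation.map_mul, hd' P hP, he' P hP]
    · rw [hS P hP]
      exact zero_le
  have hdu : ¬ IsUnit d := fun hu => htriv fun P => by
    by_cases hP : P ∈ S
    · rw [← hd' P hP, hK.ord_eq_zero_of_isUnit P hu]
    · simpa [hS P hP] using hx P
  have heu : ¬ IsUnit e := fun hu => hnu hx (hI.isUnit_of_forall_dvd fun j hj =>
    (hK.dvd_iff hx0).2 fun P => by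
      by_cases hP : P ∈ S
      · rw [← he' P hP, hK.ord_eq_zero_of_isUnit P hu, add_zero]
        exact hm P j hj
      · rw [hS P hP]
        exact zero_le)
  have hcu : ¬ IsUnit c := fun hu => hdu (hrel (hu.dvd_mul_right.1 ⟨e, hc.symm⟩) dvd_rfl)
  have hc0 : c ≠ 0 := by
    rintro rfl
    exact mul_ne_zero hd0 he0 (by simpa using hc)
  have key := hZ a b c d e hab0.1 hab0.2 hc0 hd0 he0 hau hbu hcu hdu heu (by rw [← hab, hc])
  rw [← hab] at key
  have key' := key.resolve_left (not_not.2 hrel)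
  simp only [IsRelPrime, not_forall] at key'
  obtain ⟨r, ⟨y, rfl⟩, hre, hru⟩ := key'
  have hr0 : r ≠ 0 := left_ne_zero_of_mul hx0
  have hy0 : y ≠ 0 := right_ne_zero_of_mul hx0
  -- On `S`, `r ∣ e` means that removing `r` costs at most `ord e = ord x - ord (m P)`.
  refine hxmin y ⟨hy0, fun P => ?_⟩ ⟨hy0, r, hru, mul_comm r y⟩
  by_cases hP : P ∈ S
  · have h1 := he' P hP
    have h2 := (hK.dvd_iff hr0).1 hre P
    rw [AddValuation.map_mul, add_comm] at h1
    refine (ENat.add_le_add_iff_left (htop P hr0)).1 ?_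
    rw [← h1]
    gcongr
  · have := hx P
    rw [hS P hP] at this
    exact this.trans zero_le

end IsKrullDomain

end Krull

theorem mainTheorem5 (R : Type*) [CommRing R] [IsDomain R] (hK : IsKrullDomain R)
    (hR : ¬ IsField R) :
    HasZProperty R ↔
      IsHalfFactorialDomain R ∧
        ∀ I : Ideal R, IsPrimitiveIdeal I →
          ∃ α : R, Irreducible α ∧ algebraMap R (FractionRing R) α ∈ vClosure I :=
  ⟨fun hZ => ⟨hZ.isHalfFactorialDomain hK.isAtomicDomain,
    fun _ hI => hK.exists_irreducible_mem_vClosure hR hZ hI⟩,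
    fun h => h.1.hasZProperty h.2⟩
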